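/- **Setup.** Let $\Omega$ be a finite set and $f_1,\dots,f_m\subseteq\Omega$ ("flaws"). For $\sigma\in\Omega$ let $U(\sigma)=\{i\in[m]:\sigma\in f_i\}$. For every $\sigma\in\Omega$ and $i\in U(\sigma)$ let $A(i,\sigma)\neq\{\sigma\}$ be a non-empty subset of $\Omega$ and $\rho_i(\sigma,\cdot)$ a probability distribution on $A(i,\sigma)$. Let $D$ be the multidigraph on $\Omega$ with an arc $\sigma\xrightarrow{i}\tau$ for all $i\in U(\sigma)$, $\tau\in A(i,\sigma)$; its sinks are the states $\sigma$ with $U(\sigma)=\emptyset$. The causality digraph $C$ on $[m]$ has an arc $i\to j$ (loops allowed) iff there is an arc $\sigma\xrightarrow{i}\tau$ of $D$ with $\tau\in f_j$ and ($i=j$ or $\sigma\notin f_j$). Let $\mu$ be a probability distribution on $\Omega$ with $\mu(\sigma)>0$ for all $\sigma$, and let $\gamma_i=\max_{\tau\in\Omega}\frac1{\mu(\tau)}\sum_{\sigma\in f_i}\mu(\sigma)\rho_i(\sigma,\tau)$. Let $\theta$ be a probability distribution on $\Omega$ with span $\mathcal S(\theta)=\bigcup_{\sigma:\theta(\sigma)>0}U(\sigma)$.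 For a digraph $R$ on $[m]$ let $\Gamma_R(i)=\{j: i\to j \text{ in } R\}$, let $G(R)$ be the undirected graph on $[m]$ in which distinct $i,j$ are adjacent iff both $i\to j$ and $j\to i$ are in $R$, and for $S\subseteq[m]$ let $\mathrm{Ind}(S)$ be the family of all subsets of $S$ that are independent in $G(R)$. For a permutation $\pi$ of $[m]$ and non-empty $S\subseteq[m]$ let $I_\pi(S)$ be the greatest element of $S$ according to $\pi$. The *recursive walk* is the random walk on $\Omega$ obtained by running the procedure ELIMINATE: sample $\sigma$ from $\theta$; while $U(\sigma)\neq\emptyset$, call ADDRESS$(I_\pi(U(\sigma)),\sigma)$. Here ADDRESS$(i,\sigma)$ does the following: replace $\sigma$ by a random $\tau\in A(i,\sigma)$ chosen with probability $\rho_i(\sigma,\tau)$ (this is one step of the walk); then, while $B=U(\sigma)\cap\Gamma_R(i)\neq\emptyset$ for the current state $\sigma$, call ADDRESS$(I_\pi(B),\sigma)$. **Theorem.** Let $R\supseteq C$ be arbitrary. If there are positive real numbers $\psi_1,\dots,\psi_m$ such that for every $i\in[m]$ $$\zeta_i:=\frac{\gamma_i}{\psi_i}\sum_{S\in\mathrm{Ind}(\Gamma_R(i))}\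 \prod_{j\in S}\psi_j<1,$$ then $\delta:=1-\max_{i\in[m]}\zeta_i>0$ and, for every permutation $\pi$ and every real $s$, the recursive walk reaches a sink within $(T_0+s)/\delta$ steps with probability at least $1-2^{-s}$, where $$T_0=\log_2\Big(\max_{\sigma\in\Omega}\frac{\theta(\sigma)}{\mu(\sigma)}\Big)+\log_2\Big(\sum_{S\in\mathrm{Ind}(\mathcal S(\theta))}\ \prod_{j\in S}\psi_j\Big).$$ (Empty products equal $1$; for $m=0$ the maximum of the $\zeta_i$ is read as $0$; "within $x$ steps" means within the first $\max(0,\lfloor x\rfloor)$ steps.) -/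

import Mathlib

open Finset

/-- Flaws `f_1, ..., f_m` on a finite state space `Ω`, the action sets `A(i, σ)` and the transition
probabilities `ρ_i(σ, ·)`. The actions and the transition probabilities matter only at pairs
`(i, σ)` with `σ ∈ f_i`; their values elsewhere are irrelevant. -/
structure FlawSystem (Ω : Type*) [Fintype Ω] [DecidableEq Ω] (m : ℕ) where
  /-- the flaws `f_i ⊆ Ω` -/
  flaw : Fin m → Finset Ω
  /-- the action sets `A(i, σ)` -/
  actions : Fin m → Ω → Finset Ω
  /-- the transition probabilities `ρ_i(σ, ·)` -/
  rho : Fin m → Ω → PMF Ω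
  actions_nonempty : ∀ i σ, σ ∈ flaw i → (actions i σ).Nonempty
  actions_ne_singleton : ∀ i σ, σ ∈ flaw i → actions i σ ≠ {σ}
  mem_actions_of_rho_ne_zero : ∀ i σ, σ ∈ flaw i → ∀ τ, rho i σ τ ≠ 0 → τ ∈ actions i σ

/-- The undirected graph `G(R)`: distinct `i`, `j` are joined iff both arcs are in `R`. -/
def Digraph.bidirected {V : Type*} (R : Digraph V) : SimpleGraph V where
  Adj i j := i ≠ j ∧ R.Adj i j ∧ R.Adj j i
  symm := ⟨fun _ _ h => ⟨h.1.symm, h.2.2, h.2.1⟩⟩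
  loopless := ⟨fun _ h => h.1 rfl⟩

open Classical in
/-- `Γ_R(i)`, the set of out-neighbours of `i` in `R`. -/
noncomputable def Digraph.outNbrs {m : ℕ} (R : Digraph (Fin m)) (i : Fin m) : Finset (Fin m) :=
  univ.filter fun j => R.Adj i j

open Classical in
/-- `Ind(S)`, the family of subsets of `S` that are independent in `G(R)`. -/
noncomputable def Digraph.indSubsets {m : ℕ} (R : Digraph (Fin m)) (S : Finset (Fin m)) :
    Finset (Finset (Fin m)) :=
  S.powerset.filter fun T => R.bidirected.IsIndepSet (T : Set (Fin m))

/-- `I_π(S)`, the index in `S` that is greatest according to `π`. -/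
def greatest {m : ℕ} (π : Equiv.Perm (Fin m)) (S : Finset (Fin m)) (hS : S.Nonempty) : Fin m :=
  π.symm ((S.image π).max' (hS.image π))

/-- A configuration of the recursive walk: the indices `i` of the calls `Address(i, ·)` that have
been started and have not returned (innermost call first), the current state, and the list of
the previous states (latest first). -/
structure WalkConfig (Ω : Type*) (m : ℕ) where
  stack : List (Fin m)
  state : Ω
  past : List Ω

namespace FlawSystem

variable {Ω : Type*} [Fintype Ω] [DecidableEq Ω] {m : ℕ}

/-- `U(σ)`, the set of indices of the flaws present in `σ`. -/
def U (F : FlawSystem Ω m) (σ : Ω) : Finset (Fin m) :=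
  univ.filter fun i => σ ∈ F.flaw i

/-- The multidigraph `D` on `Ω` has an arc from `σ` to `τ` labelled `i`. -/
def Arc (F : FlawSystem Ω m) (i : Fin m) (σ τ : Ω) : Prop :=
  σ ∈ F.flaw i ∧ τ ∈ F.actions i σ

/-- A sink of `D`: a state without outgoing arcs. -/
def IsSink (F : FlawSystem Ω m) (σ : Ω) : Prop :=
  ∀ i τ, ¬ F.Arc i σ τ

/-- The causality digraph `C`: there is an arc from `i` to `j` iff in some arc of `D` labelled `i`,
going from `σ` to `τ`, flaw `j` is present in `τ`, and `j = i` or flaw `j` is absent from `σ`. -/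
def causality (F : FlawSystem Ω m) : Digraph (Fin m) where
  Adj i j := ∃ σ τ, F.Arc i σ τ ∧ τ ∈ F.flaw j ∧ (i = j ∨ σ ∉ F.flaw j)

/-- The charge `γ_i = max_τ (1 / μ(τ)) ∑_{σ ∈ f_i} μ(σ) ρ_i(σ, τ)`. -/
noncomputable def charge (F : FlawSystem Ω m) (μ : PMF Ω) (i : Fin m) : ℝ :=
  ⨆ τ : Ω, 1 / (μ τ).toReal * ∑ σ ∈ F.flaw i, (μ σ).toReal * (F.rho i σ τ).toReal

/-- `ζ_i = (γ_i / ψ_i) ∑_{S ∈ Ind(Γ_R(i))} ∏_{j ∈ S} ψ_j`. -/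
noncomputable def zeta (F : FlawSystem Ω m) (μ : PMF Ω) (R : Digraph (Fin m)) (ψ : Fin m → ℝ)
    (i : Fin m) : ℝ :=
  F.charge μ i / ψ i * ∑ S ∈ R.indSubsets (R.outNbrs i), ∏ j ∈ S, ψ j

open Classical in
/-- The span of `θ`: the indices of the flaws present in some state of positive probability. -/
noncomputable def span (F : FlawSystem Ω m) (θ : PMF Ω) : Finset (Fin m) :=
  univ.filter fun i => ∃ σ, 0 < θ σ ∧ i ∈ F.U σ

/-- `T_0 = log₂ (max_σ θ(σ) / μ(σ)) + log₂ (∑_{S ∈ Ind(span θ)} ∏_{j ∈ S} ψ_j)`. -/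
noncomputable def T0 (F : FlawSystem Ω m) (μ θ : PMF Ω) (R : Digraph (Fin m)) (ψ : Fin m → ℝ) :
    ℝ :=
  Real.logb 2 (⨆ σ : Ω, (θ σ).toReal / (μ σ).toReal) +
    Real.logb 2 (∑ S ∈ R.indSubsets (F.span θ), ∏ j ∈ S, ψ j)

/-- The deterministic control flow of `Eliminate` / `Address` between two random transitions. With
the given calls pending and in state `σ`, return the flaw that is addressed next together with
the calls that are then pending below it, or `none` if `Eliminate` returns.
* No call of `Address` pending: the loop of `Eliminate` runs while `U(σ) ≠ ∅` and calls
  `Address(I_π(U(σ)), σ)`.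
* Innermost pending call `Address(i, ·)`: its loop runs while `B = U(σ) ∩ Γ_R(i) ≠ ∅` and calls
  `Address(I_π(B), σ)`; if `B = ∅` the call returns and its caller continues. -/
noncomputable def nextCall (F : FlawSystem Ω m) (R : Digraph (Fin m)) (π : Equiv.Perm (Fin m))
    (σ : Ω) : List (Fin m) → Option (Fin m × List (Fin m))
  | [] =>
      if h : (F.U σ).Nonempty then some (greatest π (F.U σ) h, []) else none
  | i :: st =>
      if h : (F.U σ ∩ R.outNbrs i).Nonempty then
        some (greatest π (F.U σ ∩ R.outNbrs i) h, i :: st)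
      else F.nextCall R π σ st

/-- One step of the recursive walk: start the next call `Address(j, σ)` and move to a random state
`τ` with law `ρ_j(σ, ·)`. If `Eliminate` has returned, nothing happens any more. -/
noncomputable def step (F : FlawSystem Ω m) (R : Digraph (Fin m)) (π : Equiv.Perm (Fin m))
    (c : WalkConfig Ω m) : PMF (WalkConfig Ω m) :=
  match F.nextCall R π c.state c.stack with
  | none => PMF.pure c
  | some (j, st) => (F.rho j c.state).map fun τ => ⟨j :: st, τ, c.state :: c.past⟩

/-- The law of the configuration of the recursive walk after (at most) `n` steps, started in a state
sampled from `θ`. -/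
noncomputable def walk (F : FlawSystem Ω m) (R : Digraph (Fin m)) (π : Equiv.Perm (Fin m))
    (θ : PMF Ω) : ℕ → PMF (WalkConfig Ω m)
  | 0 => θ.map fun σ => ⟨[], σ, []⟩
  | n + 1 => (F.walk R π θ n).bind (F.step R π)

/-- The probability that the recursive walk visits a sink within its first `n` steps. -/
noncomputable def reachProb (F : FlawSystem Ω m) (R : Digraph (Fin m)) (π : Equiv.Perm (Fin m))
    (θ : PMF Ω) (n : ℕ) : ℝ :=
  ((F.walk R π θ n).toOuterMeasure
    {c | ∃ σ ∈ c.state :: c.past, F.IsSink σ}).toReal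

end FlawSystem

/-! Calls made one after another at the same level have `π`-decreasing labels that are independent
in `G(R)`. Addressing `j` creates flaws only in `Γ_R(j)`, and `j` returns only when these are
absent. So a later sibling `k` was already present when `j` was chosen as greatest, and `k ∉
Γ_R(j)`. Hence, if `A` bounds the flaws a pending call can still select, `indWeight A` is a weighted
count of its possible sets of further sub-calls.

The proof bounds unnormalised laws `ν ≤ c • μ` of the current state. Addressing `j` turns the part
of `ν` that selects `j` into a law at most `c * γ_j • μ`. It also replaces the factor `W(A)` of the
`potential` by `W(Γ_R(j)) * W(laterSiblings A j)`. Since `γ_j * W(Γ_R(j)) ≤ r * ψ_j` with `r = max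
ζ_i`, and `∑ j ∈ A, ψ_j * W(laterSiblings A j) = W(A) - 1` (`indWeight_eq`), each step costs a
factor `r` (`sum_charge_mul_le`). Thus the `ν`-mass surviving `n` steps is at most `c * r ^ n *
potential` (`sum_survival_le`). With `ν = θ`, `c = max θ/μ` and an empty stack this is `2 ^ T0 * r ^
n`; `one_sub_reachProb_le` transfers it to the walk. -/

section Weight

/-! ### Weights of independent sets. -/

variable {m : ℕ} (R : Digraph (Fin m)) (ψ : Fin m → ℝ)

/-- The total weight `∑_{S ∈ Ind(A)} ∏_{j ∈ S} ψ_j` of the independent subsets of `A`. -/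
noncomputable def Digraph.indWeight (A : Finset (Fin m)) : ℝ :=
  ∑ S ∈ R.indSubsets A, ∏ j ∈ S, ψ j

open Classical in
/-- The elements of `A` that precede `j` in the order `π` and are not adjacent to `j` in `G(R)`. -/
noncomputable def Digraph.laterSiblings (π : Equiv.Perm (Fin m)) (A : Finset (Fin m)) (j : Fin m) :
    Finset (Fin m) :=
  A.filter fun k => π k < π j ∧ ¬ R.bidirected.Adj j k

theorem Digraph.indWeight_empty : R.indWeight ψ ∅ = 1 := by
  simp [Digraph.indWeight, Digraph.indSubsets, Finset.filter_singleton]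

open Classical in
-- Split the independent sets by whether they contain `t`; those that do are `t` plus an independent
-- set of non-neighbours.
theorem Digraph.indWeight_insert {t : Fin m} {A : Finset (Fin m)} (ht : t ∉ A) :
    R.indWeight ψ (insert t A) = R.indWeight ψ A +
      ψ t * R.indWeight ψ (A.filter fun k => ¬ R.bidirected.Adj t k) := by
  unfold Digraph.indWeight Digraph.indSubsets
  rw [Finset.sum_filter, Finset.sum_powerset_insert ht, ← Finset.sum_filter]
  congr 1
  rw [Finset.mul_sum, ← Finset.sum_filter]
  have hS : (A.powerset.filter fun T : Finset (Fin m) => R.bidirected.IsIndepSet ((insert t T : Finset _) : Set (Fin m)))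
      = (A.filter fun k => ¬ R.bidirected.Adj t k).powerset.filter
          fun T : Finset (Fin m) => R.bidirected.IsIndepSet (T : Set (Fin m)) := by
    ext T
    simp only [Finset.mem_filter, Finset.mem_powerset, Finset.coe_insert,
      SimpleGraph.isIndepSet_iff, Finset.subset_iff]
    constructor
    · rintro ⟨h1, h2⟩
      refine ⟨fun k hk => ⟨h1 hk, ?_⟩, h2.mono (Set.subset_insert _ _)⟩
      refine h2 (Set.mem_insert _ _) (Set.mem_insert_of_mem _ hk) ?_
      rintro rfl
      exact ht (h1 hk)
    · rintro ⟨h1, h2⟩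
      refine ⟨fun k hk => (h1 hk).1, ?_⟩
      intro a ha b hb hab
      rcases ha with rfl | ha <;> rcases hb with rfl | hb
      · exact absurd rfl hab
      · exact (h1 hb).2
      · exact fun h => (h1 ha).2 h.symm
      · exact h2 ha hb hab
  rw [hS]
  refine Finset.sum_congr rfl fun T hT => ?_
  rw [Finset.prod_insert]
  intro h
  simp only [Finset.mem_filter, Finset.mem_powerset] at hT
  exact ht (Finset.mem_of_mem_filter _ (hT.1 h))

/-- Independent subsets are classified by their greatest element. -/
theorem Digraph.indWeight_eq (π : Equiv.Perm (Fin m)) (A : Finset (Fin m)) :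
    R.indWeight ψ A = 1 + ∑ j ∈ A, ψ j * R.indWeight ψ (R.laterSiblings π A j) := by
  classical
  induction A using Finset.induction_on_max_value π with
  | empty => simp [Digraph.indWeight_empty]
  | insert t A ht hmax ih =>
    have hlt : ∀ x ∈ A, π x < π t := fun x hx =>
      lt_of_le_of_ne (hmax x hx) fun h => ht (π.injective h ▸ hx)
    rw [R.indWeight_insert ψ ht, ih, Finset.sum_insert ht]
    -- As `t` is `π`-maximal, the order condition is vacuous for `t`, and `t` never enters the sets
    -- of the other elements.
    have h1 : R.laterSiblings π (insert t A) t = A.filter fun k => ¬ R.bidirected.Adj t k := by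
      ext k
      simp only [Digraph.laterSiblings, Finset.mem_filter, Finset.mem_insert]
      constructor
      · rintro ⟨rfl | h, h2, h3⟩
        · exact absurd h2 (lt_irrefl _)
        · exact ⟨h, h3⟩
      · rintro ⟨h, h3⟩
        exact ⟨Or.inr h, hlt k h, h3⟩
    have h2 : ∀ j ∈ A, R.laterSiblings π (insert t A) j = R.laterSiblings π A j := by
      intro j hj
      ext k
      simp only [Digraph.laterSiblings, Finset.mem_filter, Finset.mem_insert]
      constructor
      · rintro ⟨rfl | h, h2⟩
        · exact absurd h2.1 (hlt j hj).not_gt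
        · exact ⟨h, h2⟩
      · rintro ⟨h, h2⟩
        exact ⟨Or.inr h, h2⟩
    have h3 : ∑ j ∈ A, ψ j * R.indWeight ψ (R.laterSiblings π (insert t A) j) =
        ∑ j ∈ A, ψ j * R.indWeight ψ (R.laterSiblings π A j) :=
      Finset.sum_congr rfl fun j hj => by rw [h2 j hj]
    rw [h1, h3]
    ring

variable {ψ} in
theorem Digraph.one_le_indWeight (hψ : ∀ i, 0 < ψ i) (A : Finset (Fin m)) :
    1 ≤ R.indWeight ψ A := by
  have h : (∅ : Finset (Fin m)) ∈ R.indSubsets A := by simp [Digraph.indSubsets]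
  simpa [Digraph.indWeight] using Finset.single_le_sum (f := fun S => ∏ j ∈ S, ψ j)
    (fun S _ => Finset.prod_nonneg fun j _ => (hψ j).le) h

theorem greatest_mem (π : Equiv.Perm (Fin m)) (S : Finset (Fin m)) (hS : S.Nonempty) :
    greatest π S hS ∈ S := by
  have h := (S.image π).max'_mem (hS.image π)
  obtain ⟨a, ha, h⟩ := Finset.mem_image.1 h
  rw [greatest, ← h]
  simpa using ha

theorem le_greatest (π : Equiv.Perm (Fin m)) (S : Finset (Fin m)) (hS : S.Nonempty) {k : Fin m}
    (hk : k ∈ S) : π k ≤ π (greatest π S hS) := by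
  rw [greatest, Equiv.apply_symm_apply]
  exact Finset.le_max' _ _ (Finset.mem_image_of_mem _ hk)

end Weight

/-! ### Admissible sub-calls, survival probabilities and charges. -/

namespace FlawSystem

variable {Ω : Type*} [Fintype Ω] [DecidableEq Ω] {m : ℕ}

theorem mem_U (F : FlawSystem Ω m) {σ : Ω} {i : Fin m} : i ∈ F.U σ ↔ σ ∈ F.flaw i := by
  simp [U]

theorem isSink_iff (F : FlawSystem Ω m) (σ : Ω) : F.IsSink σ ↔ F.U σ = ∅ := by
  constructor
  · intro h
    refine Finset.eq_empty_of_forall_notMem fun i hi => ?_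
    rw [mem_U] at hi
    obtain ⟨τ, hτ⟩ := F.actions_nonempty i σ hi
    exact h i τ ⟨hi, hτ⟩
  · rintro h i τ ⟨h1, -⟩
    rw [← mem_U, h] at h1
    simp at h1

/-- The flaws `V` can only be addressed below the calls in `E` in accordance with the sets of
still admissible sub-calls recorded in `E` and, at the root level, in `A₀`. -/
def Admissible (R : Digraph (Fin m)) (A₀ : Finset (Fin m)) :
    Finset (Fin m) → List (Fin m × Finset (Fin m)) → Prop
  | V, [] => V ⊆ A₀
  | V, (i, A) :: E => V ∩ R.outNbrs i ⊆ A ∧ Admissible R A₀ (V \ R.outNbrs i) E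

theorem Admissible.mono {R : Digraph (Fin m)} {A₀ : Finset (Fin m)}
    {E : List (Fin m × Finset (Fin m))} {V W : Finset (Fin m)} (h : Admissible R A₀ W E)
    (hVW : V ⊆ W) : Admissible R A₀ V E := by
  induction E generalizing V W with
  | nil => exact hVW.trans h
  | cons a E ih =>
    exact ⟨(Finset.inter_subset_inter_right hVW).trans h.1,
      ih h.2 (Finset.sdiff_subset_sdiff hVW subset_rfl)⟩

/-- The product of the weights of the sets of still admissible sub-calls. -/
noncomputable def potential (R : Digraph (Fin m)) (ψ : Fin m → ℝ) (A₀ : Finset (Fin m))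
    (E : List (Fin m × Finset (Fin m))) : ℝ :=
  (E.map fun a => R.indWeight ψ a.2).prod * R.indWeight ψ A₀

theorem potential_cons (R : Digraph (Fin m)) (ψ : Fin m → ℝ) (A₀ : Finset (Fin m))
    (a : Fin m × Finset (Fin m)) (E : List (Fin m × Finset (Fin m))) :
    potential R ψ A₀ (a :: E) = R.indWeight ψ a.2 * potential R ψ A₀ E := by
  simp [potential, mul_assoc]

theorem one_le_potential (R : Digraph (Fin m)) {ψ : Fin m → ℝ} (hψ : ∀ i, 0 < ψ i)
    (A₀ : Finset (Fin m)) (E : List (Fin m × Finset (Fin m))) : 1 ≤ potential R ψ A₀ E := by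
  induction E with
  | nil => simpa [potential] using R.one_le_indWeight hψ A₀
  | cons a E ih =>
    rw [potential_cons]
    exact one_le_mul_of_one_le_of_one_le (R.one_le_indWeight hψ _) ih

/-- Addressing flaw `j` introduces only flaws in `Γ_R(j)`. -/
theorem U_sdiff_subset (F : FlawSystem Ω m) {R : Digraph (Fin m)} (hR : F.causality ≤ R)
    {j : Fin m} {σ τ : Ω} (h : F.Arc j σ τ) : F.U τ \ R.outNbrs j ⊆ (F.U σ).erase j := by
  intro k hk
  simp only [Finset.mem_sdiff, mem_U, Digraph.outNbrs, Finset.mem_filter, Finset.mem_univ,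
    true_and] at hk
  have h1 : ¬ (j = k ∨ σ ∉ F.flaw k) := fun h2 => hk.2 (hR ⟨σ, τ, h, hk.1, h2⟩)
  push Not at h1
  exact Finset.mem_erase.2 ⟨h1.1.symm, F.mem_U.2 h1.2⟩

/-- The invariant behind independence of siblings. `G` is the set that the current loop scans:
`Γ_R(i)` inside a call, `univ` at the root. A flaw of `G` outside `Γ_R(j)` after addressing `j` was
present before, hence lost to `j` in the order `π`. -/
theorem sdiff_inter_subset_laterSiblings (F : FlawSystem Ω m) {R : Digraph (Fin m)}
    (hR : F.causality ≤ R) (π : Equiv.Perm (Fin m)) {G A : Finset (Fin m)} {σ τ : Ω}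
    (hne : (F.U σ ∩ G).Nonempty) (hA : F.U σ ∩ G ⊆ A)
    (h : F.Arc (greatest π (F.U σ ∩ G) hne) σ τ) :
    (F.U τ \ R.outNbrs (greatest π (F.U σ ∩ G) hne)) ∩ G ⊆
      R.laterSiblings π A (greatest π (F.U σ ∩ G) hne) := by
  classical
  intro k hk
  rw [Finset.mem_inter] at hk
  have h1 := Finset.mem_erase.1 (F.U_sdiff_subset hR h hk.1)
  have h2 : k ∈ F.U σ ∩ G := Finset.mem_inter.2 ⟨h1.2, hk.2⟩
  refine Finset.mem_filter.2 ⟨hA h2, lt_of_le_of_ne (le_greatest π _ hne h2) fun h3 =>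
    h1.1 (π.injective h3), fun h3 => ?_⟩
  exact (Finset.mem_sdiff.1 hk.1).2 (by simpa [Digraph.outNbrs] using h3.2.1)

/-- The probability that the walk makes at least `n` further steps. -/
noncomputable def survival (F : FlawSystem Ω m) (R : Digraph (Fin m)) (π : Equiv.Perm (Fin m)) :
    ℕ → List (Fin m) → Ω → ENNReal
  | 0, _, _ => 1
  | n + 1, st, σ =>
    match F.nextCall R π σ st with
    | none => 0
    | some (j, st') => ∑ τ, F.rho j σ τ * F.survival R π n (j :: st') τ

theorem survival_le_one (F : FlawSystem Ω m) (R : Digraph (Fin m)) (π : Equiv.Perm (Fin m))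
    (n : ℕ) (st : List (Fin m)) (σ : Ω) : F.survival R π n st σ ≤ 1 := by
  induction n generalizing st σ with
  | zero => simp [survival]
  | succ n ih =>
    unfold survival
    split
    · simp
    · rename_i j st' _
      calc ∑ τ, F.rho j σ τ * F.survival R π n (j :: st') τ ≤ ∑ τ, F.rho j σ τ :=
            Finset.sum_le_sum fun τ _ => mul_le_of_le_one_right' (ih _ _)
        _ = 1 := by rw [← tsum_fintype (L := .unconditional Ω)]; exact (F.rho j σ).tsum_coe

theorem toReal_survival_some (F : FlawSystem Ω m) {R : Digraph (Fin m)} {π : Equiv.Perm (Fin m)}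
    {n : ℕ} {st st' : List (Fin m)} {σ : Ω} {j : Fin m}
    (h : F.nextCall R π σ st = some (j, st')) :
    (F.survival R π (n + 1) st σ).toReal =
      ∑ τ, (F.rho j σ τ).toReal * (F.survival R π n (j :: st') τ).toReal := by
  rw [survival, h]
  dsimp only
  rw [ENNReal.toReal_sum]
  · simp
  · intro τ _
    exact ENNReal.mul_ne_top (PMF.apply_ne_top _ _)
      ((F.survival_le_one R π _ _ _).trans_lt ENNReal.one_lt_top).ne

theorem toReal_survival_none (F : FlawSystem Ω m) {R : Digraph (Fin m)} {π : Equiv.Perm (Fin m)}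
    {n : ℕ} {st : List (Fin m)} {σ : Ω} (h : F.nextCall R π σ st = none) :
    (F.survival R π (n + 1) st σ).toReal = 0 := by
  rw [survival, h]
  simp

theorem charge_nonneg (F : FlawSystem Ω m) (μ : PMF Ω) (i : Fin m) : 0 ≤ F.charge μ i :=
  Real.iSup_nonneg fun τ => mul_nonneg (by positivity)
    (Finset.sum_nonneg fun σ _ => by positivity)

theorem sum_mul_rho_le (F : FlawSystem Ω m) {μ : PMF Ω} (hμ : ∀ σ, 0 < μ σ) (i : Fin m) (τ : Ω) :
    ∑ σ ∈ F.flaw i, (μ σ).toReal * (F.rho i σ τ).toReal ≤ F.charge μ i * (μ τ).toReal := by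
  have h0 : 0 < (μ τ).toReal := ENNReal.toReal_pos (hμ τ).ne' (PMF.apply_ne_top _ _)
  have h : 1 / (μ τ).toReal * ∑ σ ∈ F.flaw i, (μ σ).toReal * (F.rho i σ τ).toReal
      ≤ F.charge μ i :=
    le_ciSup (f := fun τ : Ω => 1 / (μ τ).toReal *
      ∑ σ ∈ F.flaw i, (μ σ).toReal * (F.rho i σ τ).toReal) (Set.finite_range _).bddAbove τ
  rwa [one_div, inv_mul_le_iff₀ h0, mul_comm] at h

end FlawSystem

/-! ### Geometric decay of the survival probability. -/

namespace FlawSystem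

variable {Ω : Type*} [Fintype Ω] [DecidableEq Ω] {m : ℕ}

theorem nextCall_nil (F : FlawSystem Ω m) {R : Digraph (Fin m)} {π : Equiv.Perm (Fin m)} {σ : Ω}
    (h : (F.U σ ∩ univ).Nonempty) :
    F.nextCall R π σ [] = some (greatest π (F.U σ ∩ univ) h, []) := by
  have h' : (F.U σ).Nonempty := by simpa using h
  simp [nextCall, h']

theorem nextCall_nil_of_eq_empty (F : FlawSystem Ω m) {R : Digraph (Fin m)}
    {π : Equiv.Perm (Fin m)} {σ : Ω} (h : F.U σ ∩ univ = ∅) : F.nextCall R π σ [] = none := by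
  have h' : F.U σ = ∅ := by simpa using h
  simp [nextCall, h']

theorem nextCall_cons (F : FlawSystem Ω m) {R : Digraph (Fin m)} {π : Equiv.Perm (Fin m)} {σ : Ω}
    {i : Fin m} {st : List (Fin m)} (h : (F.U σ ∩ R.outNbrs i).Nonempty) :
    F.nextCall R π σ (i :: st) = some (greatest π (F.U σ ∩ R.outNbrs i) h, i :: st) := by
  rw [nextCall, dif_pos h]

theorem nextCall_cons_of_eq_empty (F : FlawSystem Ω m) {R : Digraph (Fin m)}
    {π : Equiv.Perm (Fin m)} {σ : Ω} {i : Fin m} {st : List (Fin m)}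
    (h : F.U σ ∩ R.outNbrs i = ∅) :
    F.nextCall R π σ (i :: st) = F.nextCall R π σ st := by
  rw [nextCall, dif_neg (by rw [h]; exact Finset.not_nonempty_empty)]

theorem survival_cons_of_eq_empty (F : FlawSystem Ω m) {R : Digraph (Fin m)}
    {π : Equiv.Perm (Fin m)} {σ : Ω} {i : Fin m} {st : List (Fin m)} {n : ℕ}
    (h : F.U σ ∩ R.outNbrs i = ∅) :
    F.survival R π (n + 1) (i :: st) σ = F.survival R π (n + 1) st σ := by
  rw [survival, survival, F.nextCall_cons_of_eq_empty h]

/-- A bound on the probability of `n` further steps, summed over the next flaw to be addressed. -/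
theorem sum_survival_succ_le (F : FlawSystem Ω m) {μ : PMF Ω} (hμ : ∀ σ, 0 < μ σ)
    {R : Digraph (Fin m)} {π : Equiv.Perm (Fin m)} {n : ℕ} {st₀ st : List (Fin m)}
    {G A : Finset (Fin m)} {c : ℝ} (hc : 0 ≤ c) {ν : Ω → ℝ} (hν : ∀ σ, 0 ≤ ν σ)
    (hνμ : ∀ σ, ν σ ≤ c * (μ σ).toReal)
    (hsupp : ∀ σ, ν σ ≠ 0 → (F.U σ ∩ G).Nonempty ∧ F.U σ ∩ G ⊆ A)
    (hnext : ∀ σ (h : (F.U σ ∩ G).Nonempty),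
      F.nextCall R π σ st₀ = some (greatest π (F.U σ ∩ G) h, st))
    {K : Fin m → ℝ}
    (hK : ∀ j ∈ A, ∀ c' : ℝ, 0 ≤ c' → ∀ ν' : Ω → ℝ, (∀ τ, 0 ≤ ν' τ) →
      (∀ τ, ν' τ ≤ c' * (μ τ).toReal) →
      (∀ τ, ν' τ ≠ 0 → ∃ σ, ∃ h : (F.U σ ∩ G).Nonempty, ν σ ≠ 0 ∧
        greatest π (F.U σ ∩ G) h = j ∧ F.Arc j σ τ) →
      ∑ τ, ν' τ * (F.survival R π n (j :: st) τ).toReal ≤ c' * K j) :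
    ∑ σ, ν σ * (F.survival R π (n + 1) st₀ σ).toReal ≤ c * ∑ j ∈ A, F.charge μ j * K j := by
  classical
  let sel : Fin m → Ω → Prop := fun j σ =>
    ∃ h : (F.U σ ∩ G).Nonempty, greatest π (F.U σ ∩ G) h = j
  -- The part of `ν` that selects `j`, pushed forward along `ρ_j`; the charge bounds it by `c * γ_j
  -- • μ`.
  let ν' : Fin m → Ω → ℝ := fun j τ =>
    ∑ σ, if sel j σ then ν σ * (F.rho j σ τ).toReal else 0
  have hmem : ∀ j σ, sel j σ → σ ∈ F.flaw j := by
    rintro j σ ⟨h, rfl⟩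
    exact F.mem_U.1 (Finset.mem_inter.1 (greatest_mem π _ h)).1
  have hsplit : ∀ σ, ν σ * (F.survival R π (n + 1) st₀ σ).toReal =
      ∑ j ∈ A, if sel j σ then
        ν σ * ∑ τ, (F.rho j σ τ).toReal * (F.survival R π n (j :: st) τ).toReal else 0 := by
    intro σ
    by_cases h0 : ν σ = 0
    · simp [h0]
    · obtain ⟨hne, hA⟩ := hsupp σ h0
      rw [F.toReal_survival_some (hnext σ hne),
        Finset.sum_eq_single_of_mem _ (hA (greatest_mem π _ hne)), if_pos ⟨hne, rfl⟩]
      intro j _ hj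
      rw [if_neg]
      rintro ⟨_, h⟩
      exact hj h.symm
  calc ∑ σ, ν σ * (F.survival R π (n + 1) st₀ σ).toReal
      = ∑ j ∈ A, ∑ τ, ν' j τ * (F.survival R π n (j :: st) τ).toReal := by
        simp_rw [hsplit]
        rw [Finset.sum_comm]
        refine Finset.sum_congr rfl fun j _ => ?_
        simp_rw [ν', Finset.sum_mul]
        rw [Finset.sum_comm]
        refine Finset.sum_congr rfl fun σ _ => ?_
        split_ifs
        · rw [Finset.mul_sum]
          exact Finset.sum_congr rfl fun τ _ => (mul_assoc _ _ _).symm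
        · simp
    _ ≤ ∑ j ∈ A, (c * F.charge μ j) * K j := by
        refine Finset.sum_le_sum fun j hj => hK j hj _ (mul_nonneg hc (F.charge_nonneg μ j)) _
          (fun τ => ?_) (fun τ => ?_) (fun τ hτ => ?_)
        · refine Finset.sum_nonneg fun σ _ => ?_
          split_ifs
          · exact mul_nonneg (hν σ) ENNReal.toReal_nonneg
          · exact le_rfl
        · calc ν' j τ ≤ ∑ σ, if σ ∈ F.flaw j then
                c * ((μ σ).toReal * (F.rho j σ τ).toReal) else 0 := by
                refine Finset.sum_le_sum fun σ _ => ?_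
                by_cases h : sel j σ
                · rw [if_pos h, if_pos (hmem j σ h), ← mul_assoc]
                  exact mul_le_mul_of_nonneg_right (hνμ σ) ENNReal.toReal_nonneg
                · rw [if_neg h]
                  split_ifs <;> positivity
            _ = c * ∑ σ ∈ F.flaw j, (μ σ).toReal * (F.rho j σ τ).toReal := by
                rw [← Finset.sum_filter, Finset.filter_univ_mem, Finset.mul_sum]
            _ ≤ c * F.charge μ j * (μ τ).toReal := by
                rw [mul_assoc]
                exact mul_le_mul_of_nonneg_left (F.sum_mul_rho_le hμ j τ) hc
        · obtain ⟨σ, -, hσ⟩ := Finset.exists_ne_zero_of_sum_ne_zero hτ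
          split_ifs at hσ with hs
          · have hρ : F.rho j σ τ ≠ 0 := fun h => hσ (by simp [h])
            exact ⟨σ, hs.1, left_ne_zero_of_mul hσ, hs.2, hmem j σ hs,
              F.mem_actions_of_rho_ne_zero j σ (hmem j σ hs) τ hρ⟩
          · exact absurd rfl hσ
    _ = c * ∑ j ∈ A, F.charge μ j * K j := by
        rw [Finset.mul_sum]
        exact Finset.sum_congr rfl fun j _ => mul_assoc _ _ _

variable (F : FlawSystem Ω m) {μ : PMF Ω} {R : Digraph (Fin m)} {ψ : Fin m → ℝ}

/-- The only use of `ζ_j ≤ r`. The `-1` removes the empty set, which stands for making no further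
sub-call. -/
theorem sum_charge_mul_le (hψ : ∀ i, 0 < ψ i) {r : ℝ} (hr : ∀ i, F.zeta μ R ψ i ≤ r)
    (π : Equiv.Perm (Fin m)) (A : Finset (Fin m)) :
    ∑ j ∈ A, F.charge μ j * (R.indWeight ψ (R.outNbrs j) *
      R.indWeight ψ (R.laterSiblings π A j)) ≤ r * (R.indWeight ψ A - 1) := by
  rw [R.indWeight_eq ψ π A, add_sub_cancel_left, Finset.mul_sum]
  refine Finset.sum_le_sum fun j _ => ?_
  have h : F.charge μ j * R.indWeight ψ (R.outNbrs j) ≤ r * ψ j := by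
    have h1 := hr j
    rw [zeta, div_mul_eq_mul_div, div_le_iff₀ (hψ j)] at h1
    exact h1
  rw [← mul_assoc, ← mul_assoc]
  exact mul_le_mul_of_nonneg_right h (zero_le_one.trans (R.one_le_indWeight hψ _))

/-- The probability of `n` further steps decays geometrically. -/
theorem sum_survival_le (hμ : ∀ σ, 0 < μ σ) (hR : F.causality ≤ R) (hψ : ∀ i, 0 < ψ i) {r : ℝ}
    (hr0 : 0 ≤ r) (hr : ∀ i, F.zeta μ R ψ i ≤ r) (π : Equiv.Perm (Fin m)) (n : ℕ)
    (E : List (Fin m × Finset (Fin m))) (A₀ : Finset (Fin m)) {c : ℝ} (hc : 0 ≤ c) {ν : Ω → ℝ}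
    (hν : ∀ σ, 0 ≤ ν σ) (hνμ : ∀ σ, ν σ ≤ c * (μ σ).toReal)
    (hadm : ∀ σ, ν σ ≠ 0 → Admissible R A₀ (F.U σ) E) :
    ∑ σ, ν σ * (F.survival R π n (E.map Prod.fst) σ).toReal ≤
      c * (r ^ n * potential R ψ A₀ E) := by
  classical
  have hμ1 : ∑ σ, (μ σ).toReal = 1 := by
    rw [← ENNReal.toReal_sum fun σ _ => PMF.apply_ne_top _ _,
      ← tsum_fintype (L := .unconditional Ω), μ.tsum_coe, ENNReal.toReal_one]
  induction n generalizing E A₀ c ν with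
  | zero =>
    calc ∑ σ, ν σ * (F.survival R π 0 (E.map Prod.fst) σ).toReal
        ≤ ∑ σ, c * (μ σ).toReal := Finset.sum_le_sum fun σ _ => by simpa [survival] using hνμ σ
      _ = c * 1 := by rw [← Finset.mul_sum, hμ1]
      _ ≤ c * (r ^ 0 * potential R ψ A₀ E) := by
        rw [pow_zero, one_mul]
        exact mul_le_mul_of_nonneg_left (one_le_potential R hψ A₀ E) hc
  | succ n ihn =>
    -- The sharper bound with `-1` discounts the history in which every pending call returns at
    -- once. It makes the induction on the stack close: `P(a :: E) - 1 = (W(A) - 1) * P(E) + (P(E) -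
    -- 1)`, the summands being "the innermost call makes a sub-call" and "it returns".
    suffices h : ∑ σ, ν σ * (F.survival R π (n + 1) (E.map Prod.fst) σ).toReal ≤
        c * (r ^ (n + 1) * (potential R ψ A₀ E - 1)) by
      refine h.trans (mul_le_mul_of_nonneg_left (mul_le_mul_of_nonneg_left ?_ ?_) hc)
      · linarith
      · positivity
    induction E generalizing ν with
    | nil =>
      have hcall : ∑ σ, (if (F.U σ ∩ univ).Nonempty then ν σ else 0) *
          (F.survival R π (n + 1) [] σ).toReal ≤ c * ∑ j ∈ A₀, F.charge μ j *
            (r ^ n * potential R ψ (R.laterSiblings π A₀ j) [(j, R.outNbrs j)]) := by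
        refine F.sum_survival_succ_le hμ (G := univ) (A := A₀) (st := []) hc
          ?_ ?_ ?_ (fun σ h => F.nextCall_nil h) ?_
        · intro σ; split_ifs
          exacts [hν σ, le_rfl]
        · intro σ; split_ifs
          exacts [hνμ σ, by positivity]
        · intro σ hσ
          split_ifs at hσ with h
          · exact ⟨h, Finset.inter_subset_left.trans (hadm σ hσ)⟩
          · exact absurd rfl hσ
        · intro j _ c' hc' ν' h0 h1 h2
          refine ihn [(j, R.outNbrs j)] (R.laterSiblings π A₀ j) hc' h0 h1 fun τ hτ => ?_
          obtain ⟨σ, h, hσ, rfl, harc⟩ := h2 τ hτ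
          rw [if_pos h] at hσ
          refine ⟨Finset.inter_subset_right, ?_⟩
          have := F.sdiff_inter_subset_laterSiblings hR π h
            (Finset.inter_subset_left.trans (hadm σ hσ)) harc
          rwa [Finset.inter_univ (_ \ _)] at this
      refine (Finset.sum_le_sum fun σ _ => ?_).trans
        (hcall.trans (mul_le_mul_of_nonneg_left ?_ hc))
      · split_ifs with h
        · rfl
        · rw [Finset.not_nonempty_iff_eq_empty] at h
          rw [List.map_nil, F.toReal_survival_none (F.nextCall_nil_of_eq_empty h)]
          simp
      · have h := mul_le_mul_of_nonneg_left (F.sum_charge_mul_le hψ hr π A₀) (pow_nonneg hr0 n)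
        rw [Finset.mul_sum] at h
        refine (Eq.trans_le (Finset.sum_congr rfl fun j _ => ?_) h).trans_eq ?_
        · simp only [potential, List.map_cons, List.map_nil, List.prod_cons, List.prod_nil]
          ring
        · simp only [potential, List.map_nil, List.prod_nil]
          ring
    | cons a E ihE =>
      obtain ⟨i, A⟩ := a
      have hcall : ∑ σ, (if (F.U σ ∩ R.outNbrs i).Nonempty then ν σ else 0) *
          (F.survival R π (n + 1) (i :: E.map Prod.fst) σ).toReal ≤
          c * ∑ j ∈ A, F.charge μ j * (r ^ n * potential R ψ A₀
            ((j, R.outNbrs j) :: (i, R.laterSiblings π A j) :: E)) := by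
        refine F.sum_survival_succ_le hμ (G := R.outNbrs i) (A := A) (st := i :: E.map Prod.fst) hc
          ?_ ?_ ?_ (fun σ h => F.nextCall_cons h) ?_
        · intro σ; split_ifs
          exacts [hν σ, le_rfl]
        · intro σ; split_ifs
          exacts [hνμ σ, by positivity]
        · intro σ hσ
          split_ifs at hσ with h
          · exact ⟨h, (hadm σ hσ).1⟩
          · exact absurd rfl hσ
        · intro j _ c' hc' ν' h0 h1 h2
          -- The new call may start with any label in `Γ_R(j)`; its parent keeps only the later
          -- siblings of `j`.
          refine ihn ((j, R.outNbrs j) :: (i, R.laterSiblings π A j) :: E) A₀ hc' h0 h1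
            fun τ hτ => ?_
          obtain ⟨σ, h, hσ, rfl, harc⟩ := h2 τ hτ
          rw [if_pos h] at hσ
          refine ⟨Finset.inter_subset_right,
            F.sdiff_inter_subset_laterSiblings hR π h (hadm σ hσ).1 harc, ?_⟩
          exact (hadm σ hσ).2.mono (Finset.sdiff_subset_sdiff
            ((F.U_sdiff_subset hR harc).trans (Finset.erase_subset _ _)) subset_rfl)
      have hret : ∑ σ, (if (F.U σ ∩ R.outNbrs i).Nonempty then 0 else ν σ) *
          (F.survival R π (n + 1) (E.map Prod.fst) σ).toReal ≤
          c * (r ^ (n + 1) * (potential R ψ A₀ E - 1)) := by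
        refine ihE ?_ ?_ ?_
        · intro σ; split_ifs
          exacts [le_rfl, hν σ]
        · intro σ; split_ifs
          exacts [by positivity, hνμ σ]
        · intro σ hσ
          split_ifs at hσ with h
          · exact absurd rfl hσ
          -- On return `U σ` misses `Γ_R(i)`, so nothing is lost in passing to the outer stack.
          · rw [Finset.not_nonempty_iff_eq_empty, ← Finset.disjoint_iff_inter_eq_empty] at h
            have := (hadm σ hσ).2
            rwa [Finset.sdiff_eq_self_of_disjoint h] at this
      have hweight : ∑ j ∈ A, F.charge μ j * (r ^ n * potential R ψ A₀
            ((j, R.outNbrs j) :: (i, R.laterSiblings π A j) :: E)) ≤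
          r ^ (n + 1) * ((R.indWeight ψ A - 1) * potential R ψ A₀ E) := by
        have h := mul_le_mul_of_nonneg_left (F.sum_charge_mul_le hψ hr π A)
          (mul_nonneg (pow_nonneg hr0 n) (zero_le_one.trans (one_le_potential R hψ A₀ E)))
        rw [Finset.mul_sum] at h
        refine (Eq.trans_le (Finset.sum_congr rfl fun j _ => ?_) h).trans_eq ?_
        · simp only [potential_cons]
          ring
        · ring
      calc ∑ σ, ν σ * (F.survival R π (n + 1) (((i, A) :: E).map Prod.fst) σ).toReal
          = ∑ σ, (if (F.U σ ∩ R.outNbrs i).Nonempty then ν σ else 0) *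
              (F.survival R π (n + 1) (i :: E.map Prod.fst) σ).toReal +
            ∑ σ, (if (F.U σ ∩ R.outNbrs i).Nonempty then 0 else ν σ) *
              (F.survival R π (n + 1) (E.map Prod.fst) σ).toReal := by
            rw [← Finset.sum_add_distrib]
            refine Finset.sum_congr rfl fun σ _ => ?_
            split_ifs with h
            · simp
            · rw [Finset.not_nonempty_iff_eq_empty] at h
              rw [List.map_cons, F.survival_cons_of_eq_empty h]
              ring
        _ ≤ c * (r ^ (n + 1) * ((R.indWeight ψ A - 1) * potential R ψ A₀ E)) +
            c * (r ^ (n + 1) * (potential R ψ A₀ E - 1)) :=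
            add_le_add (hcall.trans (mul_le_mul_of_nonneg_left hweight hc)) hret
        _ = c * (r ^ (n + 1) * (potential R ψ A₀ ((i, A) :: E) - 1)) := by
            rw [potential_cons]
            ring

end FlawSystem

/-! ### Transfer from survival probabilities to the law of the walk. -/

theorem PMF.tsum_bind_mul {α β : Type*} (p : PMF α) (f : α → PMF β) (g : β → ENNReal) :
    ∑' b, (p.bind f) b * g b = ∑' a, p a * ∑' b, f a b * g b := by
  simp_rw [PMF.bind_apply, ← ENNReal.tsum_mul_right, ← ENNReal.tsum_mul_left]
  rw [ENNReal.tsum_comm]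
  simp_rw [mul_assoc]

theorem PMF.tsum_pure_mul {α : Type*} (a : α) (g : α → ENNReal) :
    ∑' b, PMF.pure a b * g b = g a := by
  classical
  rw [tsum_eq_single a]
  · simp
  · intro b hb
    simp [PMF.pure_apply, hb]

theorem PMF.tsum_map_mul {α β : Type*} (p : PMF α) (f : α → β) (g : β → ENNReal) :
    ∑' b, (p.map f) b * g b = ∑' a, p a * g (f a) := by
  rw [← PMF.bind_pure_comp, PMF.tsum_bind_mul]
  simp_rw [Function.comp_apply, PMF.tsum_pure_mul]

namespace FlawSystem

variable {Ω : Type*} [Fintype Ω] [DecidableEq Ω] {m : ℕ} (F : FlawSystem Ω m)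
  (R : Digraph (Fin m)) (π : Equiv.Perm (Fin m))

/-- The horizon must be positive: a halted configuration stays put, with survival `1` at horizon `0`
but `0` at horizon `1`. -/
theorem tsum_step_mul_survival (n : ℕ) (c : WalkConfig Ω m) :
    ∑' c', F.step R π c c' * F.survival R π (n + 1) c'.stack c'.state =
      F.survival R π (n + 2) c.stack c.state := by
  rw [step]
  cases h : F.nextCall R π c.state c.stack with
  | none =>
    dsimp only
    rw [PMF.tsum_pure_mul, survival, survival, h]
  | some a =>
    obtain ⟨j, st⟩ := a
    dsimp only
    rw [PMF.tsum_map_mul, survival, h]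
    dsimp only
    rw [tsum_fintype]

theorem tsum_walk_mul_survival (θ : PMF Ω) (n k : ℕ) :
    ∑' c, F.walk R π θ n c * F.survival R π (k + 1) c.stack c.state =
      ∑ σ, θ σ * F.survival R π (n + k + 1) [] σ := by
  induction n generalizing k with
  | zero => rw [walk, PMF.tsum_map_mul, tsum_fintype, zero_add]
  | succ n ih =>
    rw [walk, PMF.tsum_bind_mul]
    simp_rw [F.tsum_step_mul_survival R π]
    rw [ih (k + 1), add_right_comm n 1 k, add_assoc n k 1]

variable {F R π}

theorem nextCall_ne_none {σ : Ω} (h : (F.U σ).Nonempty) (st : List (Fin m)) :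
    F.nextCall R π σ st ≠ none := by
  induction st with
  | nil => simp [nextCall, h]
  | cons i st ih =>
    rw [nextCall]
    split_ifs
    · simp
    · exact ih

theorem survival_one_of_nonempty {σ : Ω} (h : (F.U σ).Nonempty) (st : List (Fin m)) :
    F.survival R π 1 st σ = 1 := by
  obtain ⟨a, ha⟩ := Option.ne_none_iff_exists'.1 (nextCall_ne_none (R := R) (π := π) h st)
  rw [survival, ha]
  dsimp only
  simp_rw [survival, mul_one]
  rw [← tsum_fintype (L := .unconditional Ω)]
  exact (F.rho _ _).tsum_coe

variable (F R π)

/-- If the state after `n` steps is not a sink, then whatever calls are pending, step `n + 1` takes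
place. -/
theorem one_sub_reachProb_le (θ : PMF Ω) (n : ℕ) :
    1 - F.reachProb R π θ n ≤ ∑ σ, (θ σ).toReal * (F.survival R π (n + 1) [] σ).toReal := by
  classical
  set S : Set (WalkConfig Ω m) := {c | ∃ σ ∈ c.state :: c.past, F.IsSink σ} with hS
  have hsum : (1 : ENNReal) ≤ (F.walk R π θ n).toOuterMeasure S +
      ∑ σ, θ σ * F.survival R π (n + 1) [] σ := by
    rw [← F.tsum_walk_mul_survival R π θ n 0, PMF.toOuterMeasure_apply, ← ENNReal.tsum_add,
      ← (F.walk R π θ n).tsum_coe]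
    refine ENNReal.tsum_le_tsum fun c => ?_
    by_cases hc : c ∈ S
    · rw [Set.indicator_of_mem hc]
      exact le_self_add
    · have hU : (F.U c.state).Nonempty := by
        rw [Finset.nonempty_iff_ne_empty, Ne, ← isSink_iff]
        exact fun h => hc ⟨c.state, List.mem_cons_self, h⟩
      rw [zero_add, survival_one_of_nonempty hU, mul_one]
      exact le_add_self
  have htop : ∀ σ, θ σ * F.survival R π (n + 1) [] σ ≠ ⊤ := fun σ =>
    ENNReal.mul_ne_top (PMF.apply_ne_top _ _)
      ((F.survival_le_one R π _ _ _).trans_lt ENNReal.one_lt_top).ne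
  have hStop : (F.walk R π θ n).toOuterMeasure S ≠ ⊤ := by
    refine ((?_ : _ ≤ (1 : ENNReal)).trans_lt ENNReal.one_lt_top).ne
    rw [PMF.toOuterMeasure_apply, ← (F.walk R π θ n).tsum_coe]
    exact ENNReal.tsum_le_tsum fun c => Set.indicator_le_self _ _ c
  have hStop' : ∑ σ, θ σ * F.survival R π (n + 1) [] σ ≠ ⊤ :=
    ENNReal.sum_ne_top.2 fun σ _ => htop σ
  have h := ENNReal.toReal_mono (ENNReal.add_ne_top.2 ⟨hStop, hStop'⟩) hsum
  rw [ENNReal.toReal_one, ENNReal.toReal_add hStop hStop', ENNReal.toReal_sum fun σ _ => htop σ] at h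
  simp_rw [ENNReal.toReal_mul] at h
  rw [reachProb]
  linarith

end FlawSystem

/-! ### The tail bound. -/

theorem theorem2 {Ω : Type*} [Fintype Ω] [DecidableEq Ω] {m : ℕ} (F : FlawSystem Ω m)
    (μ : PMF Ω) (hμ : ∀ σ, 0 < μ σ) (θ : PMF Ω)
    (R : Digraph (Fin m)) (hR : F.causality ≤ R)
    (ψ : Fin m → ℝ) (hψ : ∀ i, 0 < ψ i) (hζ : ∀ i, F.zeta μ R ψ i < 1)
    (π : Equiv.Perm (Fin m)) (δ : ℝ) (hδ : δ = 1 - ⨆ i, F.zeta μ R ψ i) :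
    0 < δ ∧
      ∀ s : ℝ, 1 - (2 : ℝ) ^ (-s) ≤ F.reachProb R π θ ⌊(F.T0 μ θ R ψ + s) / δ⌋₊ := by
  classical
  set r : ℝ := ⨆ i, F.zeta μ R ψ i with hr
  have hr1 : r < 1 := by
    rcases isEmpty_or_nonempty (Fin m) with h | h
    · rw [hr, Real.iSup_of_isEmpty]
      exact one_pos
    · obtain ⟨i, hi⟩ := exists_eq_ciSup_of_finite (f := fun i => F.zeta μ R ψ i)
      rw [hr, ← hi]
      exact hζ i
  have hr0 : 0 ≤ r := Real.iSup_nonneg fun i =>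
    mul_nonneg (div_nonneg (F.charge_nonneg μ i) (hψ i).le)
      (zero_le_one.trans (R.one_le_indWeight hψ _))
  have hζr : ∀ i, F.zeta μ R ψ i ≤ r := fun i => le_ciSup (Set.finite_range _).bddAbove i
  have hδ0 : 0 < δ := by linarith
  refine ⟨hδ0, fun s => ?_⟩
  set n := ⌊(F.T0 μ θ R ψ + s) / δ⌋₊
  set l : ℝ := ⨆ σ : Ω, (θ σ).toReal / (μ σ).toReal with hl
  have hle : ∀ σ, (θ σ).toReal / (μ σ).toReal ≤ l := fun σ =>
    le_ciSup (f := fun σ => (θ σ).toReal / (μ σ).toReal) (Set.finite_range _).bddAbove σ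
  have hμ0 : ∀ σ, 0 < (μ σ).toReal := fun σ =>
    ENNReal.toReal_pos (hμ σ).ne' (PMF.apply_ne_top _ _)
  have hl0 : 0 < l := by
    obtain ⟨σ, hσ⟩ := θ.support_nonempty
    rw [PMF.mem_support_iff] at hσ
    exact (div_pos (ENNReal.toReal_pos hσ (PMF.apply_ne_top _ _)) (hμ0 σ)).trans_le (hle σ)
  have hZ0 : 0 < R.indWeight ψ (F.span θ) := one_pos.trans_le (R.one_le_indWeight hψ _)
  have hT : l * R.indWeight ψ (F.span θ) = 2 ^ F.T0 μ θ R ψ := by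
    rw [FlawSystem.T0, Real.rpow_add two_pos, Real.rpow_logb two_pos (by norm_num) hl0]
    congr 1
    exact (Real.rpow_logb two_pos (by norm_num) hZ0).symm
  have hbound : ∑ σ, (θ σ).toReal * (F.survival R π (n + 1) [] σ).toReal ≤
      l * (r ^ (n + 1) * R.indWeight ψ (F.span θ)) := by
    have h := F.sum_survival_le hμ hR hψ hr0 hζr π (n + 1) [] (F.span θ) hl0.le
      (ν := fun σ => (θ σ).toReal) (fun σ => ENNReal.toReal_nonneg)
      (fun σ => (div_le_iff₀ (hμ0 σ)).1 (hle σ)) ?_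
    · simpa [FlawSystem.potential] using h
    · intro σ hσ i hi
      refine Finset.mem_filter.2 ⟨Finset.mem_univ _, σ, ?_, hi⟩
      exact pos_iff_ne_zero.2 fun h => hσ (by simp [h])
  -- `r = 1 - δ ≤ e ^ (-δ) ≤ 2 ^ (-δ)`, as `log 2 < 1`.
  have hrδ : r ≤ (2 : ℝ) ^ (-δ) := by
    have h1 : r ≤ Real.exp (-δ) := by
      have := Real.add_one_le_exp (-δ)
      linarith
    refine h1.trans ?_
    rw [Real.rpow_def_of_pos two_pos, Real.exp_le_exp]
    nlinarith [Real.log_two_lt_d9]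
  -- The extra step `n + 1` absorbs the rounding; this also covers a negative quotient, where `n =
  -- 0`.
  have hn : F.T0 μ θ R ψ + s ≤ δ * (n + 1) := by
    have := Nat.lt_floor_add_one ((F.T0 μ θ R ψ + s) / δ)
    rw [div_lt_iff₀ hδ0, mul_comm] at this
    exact this.le
  have hpow : r ^ (n + 1) ≤ (2 : ℝ) ^ (-(F.T0 μ θ R ψ + s)) := by
    refine (pow_le_pow_left₀ hr0 hrδ _).trans ?_
    rw [← Real.rpow_natCast, ← Real.rpow_mul two_pos.le]
    refine Real.rpow_le_rpow_of_exponent_le one_le_two ?_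
    push_cast
    linarith
  have hfin : l * (r ^ (n + 1) * R.indWeight ψ (F.span θ)) ≤ (2 : ℝ) ^ (-s) := by
    calc l * (r ^ (n + 1) * R.indWeight ψ (F.span θ))
        = 2 ^ F.T0 μ θ R ψ * r ^ (n + 1) := by rw [← hT]; ring
      _ ≤ 2 ^ F.T0 μ θ R ψ * (2 : ℝ) ^ (-(F.T0 μ θ R ψ + s)) :=
        mul_le_mul_of_nonneg_left hpow (by positivity)
      _ = (2 : ℝ) ^ (-s) := by
        rw [← Real.rpow_add two_pos]
        congr 1
        ring
  have h := F.one_sub_reachProb_le R π θ n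
  linarith
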